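/- Let $d\in\mathbb N$, $0<\alpha<1$, $0<\beta\le 2$, $0<\gamma<\beta/2$, $L\in\mathbb R$, $a<t$ and $x\in\mathbb R^d$. On a probability space let $X=(X_s)_{s\ge0}$ be an isotropic $\beta$-stable process in $\mathbb R^d$ started at $x$, that is, a Lévy process (independent stationary increments, almost surely càdlàg paths) with $X_0=x$ almost surely, such that the law of $U=X_1-x$ is strictly $\beta$-stable (for all $A,B>0$ and an independent copy $U'$ of $U$, $AU+BU'$ has the law of $(A^\beta+B^\beta)^{1/\beta}U$) and all the coordinates of $U$ have the same distribution. Let $\tau=(\tau_s)_{s\ge0}$ be an $\alpha$-stable subordinator independent of $X$, that is, a real Lévy process with $\tau_0=0$ and nondecreasing paths almost surely and $\mathbb E[e^{-u\tau_1}]=e^{-u^\alpha}$ for $u\ge0$, and put $T_t=\inf\{s>0: t-\tau_s<a\}$. Let $\phi:\mathbb R^d\to\mathbb R$ be Borel measurable and let $g:\mathbb R^d\to\mathbb R$ satisfy $$|g(y)-g(z)|\le L\sum_{j=1}^d|y_j-z_j|^\gamma\qquad(y,z\in\mathbb R^d).$$ For $h>0$ let $$Z(t,x)=\phi(X_{T_t})+\int_0^{T_t}g(X_s)\,ds,\qquad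 Y_h(t,x)=\phi(X_{T_t})+\sum_{i=1}^{\lfloor T_t/h\rfloor}h\,g\bigl(X_{(i-1)h}\bigr).$$ Then there is a constant $M^2_{t,x}$ (the $2$ is an upper index, not a power), which does not depend on $h$, such that for every $h>0$ the difference $Z(t,x)-Y_h(t,x)$ is integrable and $$\mathbb E\bigl|Z(t,x)-Y_h(t,x)\bigr|\le M^2_{t,x}\,h^{\gamma/\beta}.$$ -/

import Mathlib

open MeasureTheory ProbabilityTheory Filter Topology
open scoped NNReal

/-- A Lévy process (with arbitrary starting value) indexed by `[0, ∞)`: independent and stationary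
increments, and almost surely càdlàg paths. -/
structure IsLevyProcess {Ω E : Type*} [MeasurableSpace Ω] [NormedAddCommGroup E]
    [MeasurableSpace E] (X : ℝ≥0 → Ω → E) (P : Measure Ω) : Prop where
  measurable : ∀ s, Measurable (X s)
  indep_increments : HasIndepIncrements X P
  stationary_increments : ∀ s r : ℝ≥0,
    IdentDistrib (fun ω => X (s + r) ω - X s ω) (fun ω => X r ω - X 0 ω) P P
  cadlag : ∀ᵐ ω ∂P, ∀ s : ℝ≥0,
    ContinuousWithinAt (fun r => X r ω) (Set.Ici s) s ∧
      ∃ l, Tendsto (fun r => X r ω) (𝓝[<] s) (𝓝 l)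

/-- A strictly `β`-stable law on `ℝ^d` (if `U, U'` are independent with law `ν`, then `A U + B U'`
has the law of `(A^β + B^β)^(1/β) U` for all `A, B > 0`) which is isotropic in the sense that
all the coordinates have the same distribution. -/
structure IsIsotropicStableLaw {d : ℕ} (β : ℝ) (ν : Measure (EuclideanSpace ℝ (Fin d))) :
    Prop where
  isProbabilityMeasure : IsProbabilityMeasure ν
  stable : ∀ A B : ℝ, 0 < A → 0 < B →
    Measure.conv (ν.map (fun y => A • y)) (ν.map (fun y => B • y)) =
      ν.map (fun y => (A ^ β + B ^ β) ^ (1 / β) • y)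
  isotropic : ∀ i j : Fin d, ν.map (fun y => y i) = ν.map (fun y => y j)

/-- An isotropic `β`-stable process started at `x`: a Lévy process with `X 0 = x` almost surely
such that the law of `X 1 - x` is isotropic (strictly) `β`-stable. -/
structure IsIsotropicStableProcess {Ω : Type*} [MeasurableSpace Ω] {d : ℕ} (β : ℝ)
    (x : EuclideanSpace ℝ (Fin d)) (X : ℝ≥0 → Ω → EuclideanSpace ℝ (Fin d))
    (P : Measure Ω) : Prop where
  levy : IsLevyProcess X P
  start : ∀ᵐ ω ∂P, X 0 ω = x
  law_one : IsIsotropicStableLaw β (P.map (fun ω => X 1 ω - x))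

/-- The standard `α`-stable subordinator: a Lévy process started at `0`, with almost surely
nondecreasing paths, normalised by `E[exp (-u τ₁)] = exp (-u^α)`. -/
structure IsStableSubordinator {Ω : Type*} [MeasurableSpace Ω] (α : ℝ)
    (τ : ℝ≥0 → Ω → ℝ) (P : Measure Ω) : Prop where
  levy : IsLevyProcess τ P
  start : ∀ᵐ ω ∂P, τ 0 ω = 0
  mono : ∀ᵐ ω ∂P, Monotone (fun s => τ s ω)
  laplace : ∀ u : ℝ, 0 ≤ u → ∫ ω, Real.exp (-u * τ 1 ω) ∂P = Real.exp (-u ^ α)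

/-- `T_t = inf {s > 0 : t - τ_s < a}`. -/
noncomputable def passageTime {Ω : Type*} (τ : ℝ≥0 → Ω → ℝ) (a t : ℝ) (ω : Ω) : ℝ≥0 :=
  sInf {s : ℝ≥0 | 0 < s ∧ t - τ s ω < a}

/-- `|x|_γ = ∑ j, |x_j|^γ`. -/
noncomputable def gammaNorm {d : ℕ} (γ : ℝ) (x : EuclideanSpace ℝ (Fin d)) : ℝ :=
  ∑ j, |x j| ^ γ

/-- `Z = φ(X_T) + ∫_0^T g(X_s) ds` for a random time `T`. -/
noncomputable def exactFunctional {Ω E : Type*} (φ g : E → ℝ) (X : ℝ≥0 → Ω → E)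
    (T : Ω → ℝ≥0) (ω : Ω) : ℝ :=
  φ (X (T ω) ω) + ∫ s in (0 : ℝ)..(T ω : ℝ), g (X s.toNNReal ω)

/-- `Y_h = φ(X_T) + ∑_{i=1}^{⌊T/h⌋} h g(X_{(i-1)h})` for a random time `T`. -/
noncomputable def riemannFunctional {Ω E : Type*} (φ g : E → ℝ) (X : ℝ≥0 → Ω → E)
    (T : Ω → ℝ≥0) (h : ℝ) (ω : Ω) : ℝ :=
  φ (X (T ω) ω) +
    ∑ i ∈ Finset.Icc 1 ⌊(T ω : ℝ) / h⌋₊, h * g (X (((i : ℝ) - 1) * h).toNNReal ω)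

/-! Put `θ = γ/β < 1/2`. The terms in `φ` cancel, and the Riemann sum is the integral up to `N h`,
`N = ⌊T/h⌋`, of `g` along the path frozen at left grid points. The error is therefore a
discretisation part on `(0, N h]` plus the last piece on `(N h, T]`. Self-similarity gives
increments over time `r` a `γ`-moment of at most `K r^θ`. With the Hölder bound, Tonelli and
independence of `T` and `X`, the first part costs `L K h^θ E[T]`. For the last piece, `E|g(X_s)| ≤
|g x| + L K s^θ`, and its length `≤ min(h, T) ≤ h^θ T^(1-θ)` produces the same power of `h`, again
with only `E[T]` involved. Two inputs remain. Finite `γ`-moments come from the characteristic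
function: stability forces `1 - charFun = O(|t|^(β/2))`, hence tails `O(r^(-β/2))`, enough as `γ <
β/2` (`lintegral_abs_rpow_lt_top`); scaling in time is `lintegral_increment_rpow_le`. Finiteness of
`E[T]` follows from exponential decay of `P(τ_n ≤ t - a)` (`lintegral_ratPassageTime_lt_top`).
`RandomTimeSetting.error_bound` combines them. -/

/-- Strict `β`-stability of a law on the real line. -/
def IsStrictlyStable (β : ℝ) (μ : Measure ℝ) : Prop :=
  ∀ A B : ℝ, 0 < A → 0 < B →
    Measure.conv (μ.map (fun y => A * y)) (μ.map (fun y => B * y)) =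
      μ.map (fun y => (A ^ β + B ^ β) ^ (1 / β) * y)

/-! ### Characteristic function, tails and moments of a stable law -/

namespace IsStrictlyStable

variable {β : ℝ} {μ : Measure ℝ} [IsProbabilityMeasure μ]

theorem charFun_mul (h : IsStrictlyStable β μ) {A B : ℝ} (hA : 0 < A) (hB : 0 < B) (t : ℝ) :
    charFun μ (A * t) * charFun μ (B * t) = charFun μ ((A ^ β + B ^ β) ^ (1 / β) * t) := by
  have hconv := congrArg (fun m => charFun m t) (h A B hA hB)
  have : IsProbabilityMeasure (μ.map (fun y => A * y)) :=
    Measure.isProbabilityMeasure_map (by fun_prop)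
  have : IsProbabilityMeasure (μ.map (fun y => B * y)) :=
    Measure.isProbabilityMeasure_map (by fun_prop)
  rwa [charFun_conv, charFun_map_mul, charFun_map_mul, charFun_map_mul] at hconv

theorem charFun_natCast_rpow_mul (h : IsStrictlyStable β μ) (hβ : 0 < β) {n : ℕ} (hn : n ≠ 0)
    (t : ℝ) : charFun μ ((n : ℝ) ^ (1 / β) * t) = charFun μ t ^ n := by
  induction n with
  | zero => exact absurd rfl hn
  | succ k ih =>
    rcases Nat.eq_zero_or_pos k with rfl | hk
    · simp
    · have hk' : (0 : ℝ) < k := by exact_mod_cast hk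
      have := h.charFun_mul (A := (k : ℝ) ^ (1 / β)) (B := 1) (by positivity) one_pos t
      rw [← Real.rpow_mul hk'.le, one_div_mul_cancel hβ.ne', Real.rpow_one, Real.one_rpow,
        ih hk.ne', one_mul] at this
      rw [pow_succ, this]
      push_cast
      rfl

theorem charFun_sq (h : IsStrictlyStable β μ) (hβ : 0 < β) (t : ℝ) :
    charFun μ ((2 : ℝ) ^ (-1 / β) * t) ^ 2 = charFun μ t := by
  rw [← h.charFun_natCast_rpow_mul hβ two_ne_zero, ← mul_assoc]
  push_cast
  rw [← Real.rpow_add two_pos]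
  simp [neg_div]

theorem rpow_neg_lt_one (hβ : 0 < β) : (2 : ℝ) ^ (-1 / β) < 1 :=
  Real.rpow_lt_one_of_one_lt_of_neg one_lt_two (div_neg_of_neg_of_pos (by norm_num) hβ)

/-- By `charFun_sq` a zero at `t` propagates to `q^k t → 0` with `q = 2^(-1/β)`, against continuity
and the value `1` at `0`. -/
theorem charFun_ne_zero (h : IsStrictlyStable β μ) (hβ : 0 < β) (t : ℝ) : charFun μ t ≠ 0 := by
  intro h0
  have key : ∀ k : ℕ, charFun μ (((2 : ℝ) ^ (-1 / β)) ^ k * t) = 0 := by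
    intro k
    induction k with
    | zero => simpa using h0
    | succ k ih =>
      have := h.charFun_sq hβ (((2 : ℝ) ^ (-1 / β)) ^ k * t)
      rw [ih] at this
      rw [pow_succ', mul_assoc]
      exact pow_eq_zero_iff two_ne_zero |>.1 this
  have hlim : Tendsto (fun k : ℕ => charFun μ (((2 : ℝ) ^ (-1 / β)) ^ k * t)) atTop
      (𝓝 (charFun μ (0 * t))) :=
    (continuous_charFun.tendsto _).comp
      ((tendsto_pow_atTop_nhds_zero_of_lt_one (by positivity) (rpow_neg_lt_one hβ)).mul_const t)
  simp only [key, zero_mul, charFun_zero, probReal_univ] at hlim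
  exact zero_ne_one (tendsto_nhds_unique tendsto_const_nhds hlim |>.trans (by simp))

/-- `charFun_sq` factors `1 - charFun μ s` as `(1 - charFun μ (q s)) (1 + charFun μ (q s))`. Near
`0` the second factor has norm at least `3/2`, so shrinking the argument by `q` shrinks the first by
`2/3`, which is at most `ρ = q^(β/2) = 2^(-1/2)`. Iteration gives the power `β/2`. -/
theorem exists_norm_one_sub_charFun_le (h : IsStrictlyStable β μ) (hβ : 0 < β) :
    ∃ C : ℝ, 0 ≤ C ∧ ∀ t, ‖1 - charFun μ t‖ ≤ C * |t| ^ (β / 2) := by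
  have hc : Continuous (fun t => ‖1 - charFun μ t‖) :=
    (continuous_const.sub continuous_charFun).norm
  have h0 : ‖1 - charFun μ 0‖ = 0 := by simp
  obtain ⟨δ, hδ, hδ'⟩ := Metric.continuous_iff.1 hc 0 (1 / 2) (by norm_num)
  have hsmall : ∀ t : ℝ, |t| < δ → ‖1 - charFun μ t‖ ≤ 1 / 2 := by
    intro t ht
    have := hδ' t (by simpa [Real.dist_eq] using ht)
    rw [h0, Real.dist_eq, sub_zero, abs_of_nonneg (norm_nonneg _)] at this
    exact this.le
  set q : ℝ := (2 : ℝ) ^ (-1 / β) with hq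
  have hq0 : 0 < q := by positivity
  have hq1 : q < 1 := rpow_neg_lt_one hβ
  set ρ : ℝ := q ^ (β / 2) with hρ
  have hρ0 : 0 < ρ := by positivity
  have hρ2 : ρ * ρ = 1 / 2 := by
    rw [hρ, ← Real.rpow_add hq0, hq, ← Real.rpow_mul two_pos.le]
    have : -1 / β * (β / 2 + β / 2) = -1 := by field_simp; norm_num
    rw [this, Real.rpow_neg_one]; norm_num
  have hρ1 : 1 ≤ ρ * (3 / 2) := by nlinarith
  have step : ∀ t : ℝ, |t| < δ → ∀ k : ℕ,
      |q ^ k * t| < δ ∧ ‖1 - charFun μ (q ^ k * t)‖ ≤ ρ ^ k * (1 / 2) := by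
    intro t ht k
    induction k with
    | zero => simpa using ⟨ht, by simpa using hsmall t ht⟩
    | succ k ih =>
      obtain ⟨ih1, ih2⟩ := ih
      set s := q ^ k * t
      have hs : q ^ (k + 1) * t = q * s := by rw [pow_succ', mul_assoc]
      rw [hs]
      have hlt : |q * s| < δ := by
        rw [abs_mul, abs_of_pos hq0]
        nlinarith [abs_nonneg s]
      refine ⟨hlt, ?_⟩
      have hsq := h.charFun_sq hβ s
      have hfac : (1 - charFun μ (q * s)) * (1 + charFun μ (q * s)) = 1 - charFun μ s := by
        rw [← hsq]; ring
      have hn := congrArg norm hfac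
      rw [norm_mul] at hn
      have hlow : 3 / 2 ≤ ‖1 + charFun μ (q * s)‖ := by
        have h1 := norm_sub_norm_le (2 : ℂ) (1 - charFun μ (q * s))
        have h2 := hsmall _ hlt
        have h3 : (2 : ℂ) - (1 - charFun μ (q * s)) = 1 + charFun μ (q * s) := by ring
        rw [h3] at h1
        simp only [Complex.norm_ofNat] at h1
        linarith
      have h4 : ‖1 - charFun μ (q * s)‖ * (3 / 2) ≤ ρ ^ k * (1 / 2) :=
        (mul_le_mul_of_nonneg_left hlow (norm_nonneg _)).trans (hn.le.trans ih2)
      rw [pow_succ]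
      have h5 : (0 : ℝ) ≤ ‖1 - charFun μ (q * s)‖ := norm_nonneg _
      nlinarith
  set e : ℝ := δ / 2 with he
  have he0 : 0 < e := by positivity
  refine ⟨2 * (1 / (q * e)) ^ (β / 2), by positivity, fun t => ?_⟩
  rcases eq_or_ne t 0 with rfl | ht
  · rw [h0]; positivity
  have htpos : 0 < |t| := abs_pos.2 ht
  rw [mul_assoc, ← Real.mul_rpow (by positivity) (abs_nonneg t)]
  rcases le_or_gt |t| e with hte | hte
  -- With `q^(k+1) < |t|/e ≤ q^k`, the point `t / q^k` lies in the small neighbourhood, and `k`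
  -- contractions lead from it back to `t`.
  · obtain ⟨k, hk1, hk2⟩ := exists_nat_pow_near_of_lt_one (x := |t| / e) (by positivity)
      ((div_le_one he0).2 hte) hq0 hq1
    have hqk : 0 < q ^ k := by positivity
    have h1 := (step (t / q ^ k) (by
      rw [abs_div, abs_of_pos hqk, div_lt_iff₀ hqk]
      rw [div_le_iff₀ he0] at hk2
      nlinarith) k).2
    rw [mul_div_cancel₀ _ hqk.ne'] at h1
    have h2 : ρ ^ k ≤ (1 / (q * e) * |t|) ^ (β / 2) := by
      rw [hρ, ← Real.rpow_natCast, ← Real.rpow_mul hq0.le, mul_comm (β / 2),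
        Real.rpow_mul hq0.le, Real.rpow_natCast]
      refine Real.rpow_le_rpow hqk.le ?_ (by positivity)
      rw [pow_succ] at hk1
      rw [one_div_mul_eq_div, mul_comm q e, ← div_div, le_div_iff₀ hq0]
      exact hk1.le
    have : 0 ≤ ρ ^ k := by positivity
    linarith
  · have h1 : 1 ≤ (1 / (q * e) * |t|) ^ (β / 2) := by
      refine Real.one_le_rpow ?_ (by positivity)
      rw [one_div_mul_eq_div, le_div_iff₀ (by positivity)]
      nlinarith
    have := norm_one_sub_charFun_le_two (μ := μ) (t := t)
    linarith

/-- The tail beyond `r` is controlled by the mean of `1 - charFun μ` over `|t| ≤ 2/r`. -/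
theorem exists_tail_le (h : IsStrictlyStable β μ) (hβ : 0 < β) :
    ∃ C : ℝ, 0 ≤ C ∧ ∀ r : ℝ, 0 < r → μ.real {y | r < |y|} ≤ C * r ^ (-(β / 2)) := by
  obtain ⟨C, hC0, hC⟩ := h.exists_norm_one_sub_charFun_le hβ
  refine ⟨2 * C * 2 ^ (β / 2), by positivity, fun r hr => ?_⟩
  refine (measureReal_abs_gt_le_integral_charFun hr).trans ?_
  have hb : ‖∫ t in (-2 * r⁻¹)..(2 * r⁻¹), 1 - charFun μ t‖ ≤
      C * (2 * r⁻¹) ^ (β / 2) * |2 * r⁻¹ - -2 * r⁻¹| := by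
    refine intervalIntegral.norm_integral_le_of_norm_le_const fun t ht => (hC t).trans ?_
    refine mul_le_mul_of_nonneg_left (Real.rpow_le_rpow (abs_nonneg _) ?_ (by positivity)) hC0
    have hr' : 0 < r⁻¹ := by positivity
    rw [Set.uIoc_of_le (by linarith)] at ht
    exact abs_le.2 ⟨by linarith [ht.1], ht.2⟩
  refine (mul_le_mul_of_nonneg_left hb (by positivity)).trans_eq ?_
  have h4 : |2 * r⁻¹ - -2 * r⁻¹| = 4 * r⁻¹ := by
    rw [abs_of_nonneg] <;> [ring; (have : 0 < r⁻¹ := by positivity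
                                   linarith)]
  rw [h4, Real.mul_rpow two_pos.le (by positivity), Real.inv_rpow hr.le, ← Real.rpow_neg hr.le]
  field_simp
  ring

/-- Layer-cake formula: `t^(γ-1)` is integrable at `0` since `γ > 0`, and the tail bound leaves
`t^(γ-1-β/2)`, integrable at infinity since `γ < β/2`. -/
theorem lintegral_abs_rpow_lt_top (h : IsStrictlyStable β μ) (hβ : 0 < β) {γ : ℝ} (hγ : 0 < γ)
    (hγβ : γ < β / 2) : ∫⁻ y, ENNReal.ofReal (|y| ^ γ) ∂μ < ⊤ := by
  obtain ⟨C, hC0, hC⟩ := h.exists_tail_le hβ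
  rw [lintegral_rpow_eq_lintegral_meas_lt_mul μ (Eventually.of_forall fun y => abs_nonneg y)
    (by fun_prop) hγ]
  refine ENNReal.mul_lt_top ENNReal.ofReal_lt_top ?_
  rw [← Set.Ioc_union_Ioi_eq_Ioi (zero_le_one (α := ℝ)),
    lintegral_union measurableSet_Ioi (Set.Ioc_disjoint_Ioi le_rfl)]
  refine ENNReal.add_lt_top.2 ⟨?_, ?_⟩
  · refine lt_of_le_of_lt (setLIntegral_mono' (g := fun t => ENNReal.ofReal (t ^ (γ - 1)))
      measurableSet_Ioc fun t _ => mul_le_of_le_one_left' prob_le_one) ?_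
    have := (intervalIntegral.intervalIntegrable_rpow' (a := 0) (b := 1) (r := γ - 1)
      (by linarith)).1
    exact this.lintegral_lt_top
  · refine lt_of_le_of_lt
      (setLIntegral_mono' (g := fun t => ENNReal.ofReal (C * t ^ (γ - 1 - β / 2)))
      measurableSet_Ioi fun t (ht : 1 < t) => ?_) ?_
    · have ht0 : 0 < t := by linarith
      rw [← ofReal_measureReal, ← ENNReal.ofReal_mul measureReal_nonneg]
      refine ENNReal.ofReal_le_ofReal
        ((mul_le_mul_of_nonneg_right (hC t ht0) (by positivity)).trans_eq ?_)
      rw [mul_assoc, ← Real.rpow_add ht0]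
      ring_nf
    · exact ((integrableOn_Ioi_rpow_of_lt (by linarith) one_pos).const_mul C).lintegral_lt_top

end IsStrictlyStable

/-! ### Scaling of the increments in time -/

/-- The quotient `f / g` is continuous with values in the finite set of `n`-th roots of unity, hence
constant. This identifies the law at time `1/n` from the law at time `1`. -/
theorem eq_of_pow_eq_pow_of_continuous {f g : ℝ → ℂ} {n : ℕ} (hn : n ≠ 0) (hf : Continuous f)
    (hg : Continuous g) (hg0 : ∀ t, g t ≠ 0) (h0 : f 0 = g 0) (h : ∀ t, f t ^ n = g t ^ n) :
    f = g := by
  have hfin : {z : ℂ | z ^ n = 1}.Finite := by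
    refine (Polynomial.finite_setOfPred_isRoot (p := Polynomial.X ^ n - Polynomial.C (1 : ℂ))
      (Polynomial.X_pow_sub_C_ne_zero (Nat.pos_of_ne_zero hn) 1)).subset fun z hz => ?_
    simpa [Polynomial.IsRoot, sub_eq_zero] using hz
  funext t
  have := isPreconnected_univ.constant_of_mapsTo (f := fun t => f t / g t)
    (T := {z : ℂ | z ^ n = 1}) hfin.isDiscrete (hf.div hg hg0).continuousOn
    (fun t _ => by simp [Set.mem_ofPred_eq, div_pow, h t, hg0 t]) (Set.mem_univ t) (Set.mem_univ 0)
  simp only [h0, div_self (hg0 0)] at this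
  exact (div_eq_one_iff_eq (hg0 t)).1 this

/-- The least element of `(n+1)⁻¹ ℕ` which is larger than `s`. -/
noncomputable def gridSucc (n : ℕ) (s : ℝ≥0) : ℝ≥0 :=
  ((⌊(n + 1) * s⌋₊ + 1 : ℕ) : ℝ≥0) / (n + 1 : ℕ)

theorem le_gridSucc (n : ℕ) (s : ℝ≥0) : s ≤ gridSucc n s := by
  rw [gridSucc, le_div_iff₀ (by positivity)]
  push_cast
  rw [mul_comm]
  exact (Nat.lt_floor_add_one _).le

theorem gridSucc_le (n : ℕ) (s : ℝ≥0) : gridSucc n s ≤ s + 1 / (n + 1) := by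
  rw [gridSucc, div_le_iff₀ (by positivity)]
  rw [Nat.cast_succ, Nat.cast_succ, add_mul s, one_div_mul_cancel (by positivity), mul_comm s]
  gcongr
  exact Nat.floor_le (by positivity)

theorem tendsto_gridSucc (s : ℝ≥0) : Tendsto (fun n => gridSucc n s) atTop (𝓝[≥] s) := by
  refine tendsto_nhdsWithin_iff.2 ⟨?_, Eventually.of_forall fun n => le_gridSucc n s⟩
  refine tendsto_of_tendsto_of_tendsto_of_le_of_le tendsto_const_nhds ?_
    (fun n => le_gridSucc n s) (fun n => gridSucc_le n s)
  simpa using (tendsto_const_nhds (x := s)).add (tendsto_one_div_add_atTop_nhds_zero_nat (𝕜 := ℝ≥0))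

namespace IsLevyProcess

variable {Ω : Type*} [MeasurableSpace Ω] {P : Measure Ω}

section Real

variable {Y : ℝ≥0 → Ω → ℝ}

theorem measurable_increment (hY : IsLevyProcess Y P) (s r : ℝ≥0) :
    Measurable fun ω => Y s ω - Y r ω :=
  (hY.measurable s).sub (hY.measurable r)

variable [IsProbabilityMeasure P]

theorem charFun_increment_nat_mul (hY : IsLevyProcess Y P) (r : ℝ≥0) (k : ℕ) :
    charFun (P.map fun ω => Y (k * r) ω - Y 0 ω) =
      charFun (P.map fun ω => Y r ω - Y 0 ω) ^ k := by
  induction k with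
  | zero => ext t; simp [charFun_dirac]
  | succ k ih =>
    have hind : IndepFun (fun ω => Y (k * r) ω - Y 0 ω)
        (fun ω => Y (k * r + r) ω - Y (k * r) ω) P :=
      hY.indep_increments.indepFun_sub_sub (zero_le (a := k * r)) (le_self_add)
    have h := hind.charFun_map_fun_add_eq_mul (hY.measurable_increment _ _).aemeasurable
      (hY.measurable_increment _ _).aemeasurable
    rw [(hY.stationary_increments (k * r) r).map_eq, ih, ← pow_succ] at h
    rw [← h]
    congr 2
    funext ω
    push_cast
    rw [add_mul, one_mul]
    ring

/-- The characteristic function at time `1/n` and the rescaled one at time `1` are continuous `n`-th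
roots of the same nonvanishing function, so they agree; the `m`-th power then gives time `m/n`. -/
theorem map_increment_rat (hY : IsLevyProcess Y P) {β : ℝ} (hβ : 0 < β)
    (hst : IsStrictlyStable β (P.map fun ω => Y 1 ω - Y 0 ω)) {m n : ℕ} (hm : m ≠ 0)
    (hn : n ≠ 0) :
    P.map (fun ω => Y ((m : ℝ≥0) / n) ω - Y 0 ω) =
      (P.map fun ω => Y 1 ω - Y 0 ω).map (fun y => ((m : ℝ) / n) ^ (1 / β) * y) := by
  have hprob : ∀ r, IsProbabilityMeasure (P.map fun ω => Y r ω - Y 0 ω) := fun r =>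
    Measure.isProbabilityMeasure_map (hY.measurable_increment _ _).aemeasurable
  have := hprob 1
  have := hprob ((m : ℝ≥0) / n)
  have := hprob ((n : ℝ≥0)⁻¹)
  set μ := P.map fun ω => Y 1 ω - Y 0 ω with hμ
  have : IsProbabilityMeasure (μ.map (fun y => ((m : ℝ) / n) ^ (1 / β) * y)) :=
    Measure.isProbabilityMeasure_map (by fun_prop)
  have hn' : (0 : ℝ) < n := by positivity
  have hroot : charFun (P.map fun ω => Y (n : ℝ≥0)⁻¹ ω - Y 0 ω) =
      fun t => charFun μ ((n : ℝ) ^ (-(1 / β)) * t) := by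
    refine eq_of_pow_eq_pow_of_continuous hn continuous_charFun
      (continuous_charFun.comp (by fun_prop)) (fun t => hst.charFun_ne_zero hβ _) (by simp)
      fun t => ?_
    rw [← hst.charFun_natCast_rpow_mul hβ hn, ← mul_assoc, ← Real.rpow_add hn',
      add_neg_cancel, Real.rpow_zero, one_mul, ← Pi.pow_apply,
      ← hY.charFun_increment_nat_mul, mul_inv_cancel₀ (by positivity)]
  refine Measure.ext_of_charFun ?_
  rw [div_eq_mul_inv, hY.charFun_increment_nat_mul, hroot]
  funext t
  rw [charFun_map_mul, Pi.pow_apply, ← hst.charFun_natCast_rpow_mul hβ hm, ← mul_assoc,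
    Real.div_rpow (by positivity) (by positivity), Real.rpow_neg hn'.le]
  rfl

/-- At rational times the scaling is exact. A real time is approached by rationals from the right,
where paths are right-continuous, and Fatou's lemma keeps the upper bound. -/
theorem lintegral_increment_rpow_le (hY : IsLevyProcess Y P) {β γ : ℝ} (hβ : 0 < β) (hγ : 0 < γ)
    (hst : IsStrictlyStable β (P.map fun ω => Y 1 ω - Y 0 ω))
    (hK : ∫⁻ ω, ENNReal.ofReal (|Y 1 ω - Y 0 ω| ^ γ) ∂P ≠ ⊤) (r : ℝ≥0) :
    ∫⁻ ω, ENNReal.ofReal (|Y r ω - Y 0 ω| ^ γ) ∂P ≤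
      ENNReal.ofReal ((r : ℝ) ^ (γ / β)) * ∫⁻ ω, ENNReal.ofReal (|Y 1 ω - Y 0 ω| ^ γ) ∂P := by
  set K := ∫⁻ ω, ENNReal.ofReal (|Y 1 ω - Y 0 ω| ^ γ) ∂P with hKdef
  have hmeas : Measurable fun y : ℝ => ENNReal.ofReal (|y| ^ γ) := by fun_prop
  have hgrid : ∀ n, ∫⁻ ω, ENNReal.ofReal (|Y (gridSucc n r) ω - Y 0 ω| ^ γ) ∂P =
      ENNReal.ofReal ((gridSucc n r : ℝ) ^ (γ / β)) * K := by
    intro n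
    have h1 := hY.map_increment_rat hβ hst (Nat.succ_ne_zero ⌊((n : ℝ≥0) + 1) * r⌋₊)
      (Nat.succ_ne_zero n)
    have h2 := congrArg (fun m : Measure ℝ => ∫⁻ y, ENNReal.ofReal (|y| ^ γ) ∂m) h1
    rw [lintegral_map hmeas (hY.measurable_increment _ _), lintegral_map hmeas (by fun_prop),
      lintegral_map (by fun_prop) (hY.measurable_increment _ _)] at h2
    refine h2.trans ?_
    rw [hKdef, ← lintegral_const_mul]
    swap
    · exact hmeas.comp (hY.measurable_increment _ _)
    congr 1
    funext ω
    rw [← ENNReal.ofReal_mul (by positivity), abs_mul, Real.mul_rpow (abs_nonneg _) (abs_nonneg _),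
      abs_of_nonneg (by positivity), ← Real.rpow_mul (by positivity)]
    simp [gridSucc, div_eq_inv_mul]
  have hlim : ∀ᵐ ω ∂P, Tendsto (fun n => ENNReal.ofReal (|Y (gridSucc n r) ω - Y 0 ω| ^ γ)) atTop
      (𝓝 (ENNReal.ofReal (|Y r ω - Y 0 ω| ^ γ))) := by
    filter_upwards [hY.cadlag] with ω hω
    have h1 : Tendsto (fun n => Y (gridSucc n r) ω) atTop (𝓝 (Y r ω)) :=
      (hω r).1.tendsto.comp (tendsto_gridSucc r)
    exact ENNReal.tendsto_ofReal ((h1.sub_const _).abs.rpow_const (Or.inr hγ.le))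
  calc ∫⁻ ω, ENNReal.ofReal (|Y r ω - Y 0 ω| ^ γ) ∂P
      = ∫⁻ ω, liminf (fun n => ENNReal.ofReal (|Y (gridSucc n r) ω - Y 0 ω| ^ γ)) atTop ∂P :=
        lintegral_congr_ae (hlim.mono fun ω hω => hω.liminf_eq.symm)
    _ ≤ liminf (fun n => ∫⁻ ω, ENNReal.ofReal (|Y (gridSucc n r) ω - Y 0 ω| ^ γ) ∂P) atTop :=
        lintegral_liminf_le fun n => hmeas.comp (hY.measurable_increment _ _)
    _ ≤ _ := by
        simp only [hgrid]
        refine (Tendsto.liminf_eq ?_).le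
        refine ENNReal.Tendsto.mul_const (ENNReal.tendsto_ofReal ?_) (Or.inr hK)
        refine Tendsto.rpow_const ?_ (Or.inr (by positivity))
        exact (NNReal.continuous_coe.tendsto _).comp
          ((tendsto_gridSucc r).mono_right nhdsWithin_le_nhds)

end Real

theorem coord {d : ℕ} {X : ℝ≥0 → Ω → EuclideanSpace ℝ (Fin d)} (hX : IsLevyProcess X P)
    (j : Fin d) : IsLevyProcess (fun s ω => X s ω j) P where
  measurable s := (EuclideanSpace.proj (𝕜 := ℝ) j).measurable.comp (hX.measurable s)
  indep_increments := hX.indep_increments.map (EuclideanSpace.proj (𝕜 := ℝ) j)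
  stationary_increments s r :=
    (hX.stationary_increments s r).comp (EuclideanSpace.proj (𝕜 := ℝ) j).measurable
  cadlag := by
    have hc : Continuous fun y : EuclideanSpace ℝ (Fin d) => y j := by fun_prop
    filter_upwards [hX.cadlag] with ω hω s
    obtain ⟨h1, l, hl⟩ := hω s
    exact ⟨hc.continuousAt.comp_continuousWithinAt h1, l j, (hc.tendsto l).comp hl⟩

end IsLevyProcess

namespace IsIsotropicStableProcess

variable {Ω : Type*} [MeasurableSpace Ω] {P : Measure Ω} [IsProbabilityMeasure P] {d : ℕ} {β : ℝ}
  {x : EuclideanSpace ℝ (Fin d)} {X : ℝ≥0 → Ω → EuclideanSpace ℝ (Fin d)}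

theorem isStrictlyStable_coord (hX : IsIsotropicStableProcess β x X P) (j : Fin d) :
    IsStrictlyStable β (P.map fun ω => X 1 ω j - X 0 ω j) := by
  have hm := hX.levy.measurable
  have hproj : Measurable fun y : EuclideanSpace ℝ (Fin d) => y j := by fun_prop
  have hU : Measurable fun ω => X 1 ω - x := (hm 1).sub_const x
  have hlaw : P.map (fun ω => X 1 ω j - X 0 ω j) =
      (P.map fun ω => X 1 ω - x).map (fun y => y j) := by
    rw [Measure.map_map hproj hU]
    refine Measure.map_congr ?_
    filter_upwards [hX.start] with ω hω
    simp [hω]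
  rw [hlaw]
  set ν := P.map fun ω => X 1 ω - x
  have := hX.law_one.isProbabilityMeasure
  intro A B hA hB
  have hcomm : ∀ c : ℝ, (ν.map (fun y => y j)).map (fun y => c * y) =
      (ν.map (fun y => c • y)).map (fun y => y j) := by
    intro c
    rw [Measure.map_map (by fun_prop) hproj, Measure.map_map hproj (by fun_prop)]
    rfl
  rw [hcomm, hcomm, hcomm, ← hX.law_one.stable A B hA hB]
  exact (Measure.map_conv_continuousLinearMap
    (EuclideanSpace.proj (𝕜 := ℝ) j : EuclideanSpace ℝ (Fin d) →L[ℝ] ℝ)).symm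

theorem exists_lintegral_gammaNorm_le (hX : IsIsotropicStableProcess β x X P) (hβ : 0 < β) {γ : ℝ}
    (hγ : 0 < γ) (hγβ : γ < β / 2) :
    ∃ K : ℝ, 0 ≤ K ∧ ∀ s r : ℝ≥0, ∫⁻ ω, ENNReal.ofReal (gammaNorm γ (X (s + r) ω - X s ω)) ∂P ≤
      ENNReal.ofReal (K * (r : ℝ) ^ (γ / β)) := by
  let m : Fin d → ENNReal := fun j => ∫⁻ ω, ENNReal.ofReal (|X 1 ω j - X 0 ω j| ^ γ) ∂P
  have hfin : ∀ j, m j < ⊤ := by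
    intro j
    have : IsProbabilityMeasure (P.map fun ω => X 1 ω j - X 0 ω j) :=
      Measure.isProbabilityMeasure_map ((hX.levy.coord j).measurable_increment 1 0).aemeasurable
    have := (hX.isStrictlyStable_coord j).lintegral_abs_rpow_lt_top hβ hγ hγβ
    rwa [lintegral_map (by fun_prop) ((hX.levy.coord j).measurable_increment 1 0)] at this
  have hsum : ∑ j, m j ≠ ⊤ := (ENNReal.sum_lt_top.2 fun j _ => hfin j).ne
  have hgm : Measurable fun y : EuclideanSpace ℝ (Fin d) => ENNReal.ofReal (gammaNorm γ y) := by
    unfold gammaNorm; fun_prop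
  refine ⟨(∑ j, m j).toReal, ENNReal.toReal_nonneg, fun s r => ?_⟩
  rw [ENNReal.ofReal_mul ENNReal.toReal_nonneg, ENNReal.ofReal_toReal hsum]
  calc ∫⁻ ω, ENNReal.ofReal (gammaNorm γ (X (s + r) ω - X s ω)) ∂P
      = ∫⁻ ω, ENNReal.ofReal (gammaNorm γ (X r ω - X 0 ω)) ∂P :=
        ((hX.levy.stationary_increments s r).comp hgm).lintegral_eq
    _ = ∑ j, ∫⁻ ω, ENNReal.ofReal (|X r ω j - X 0 ω j| ^ γ) ∂P := by
        rw [← lintegral_finsetSum]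
        · congr 1
          funext ω
          rw [gammaNorm, ENNReal.ofReal_sum_of_nonneg fun j _ => by positivity]
          rfl
        · intro j _
          have := (hX.levy.coord j).measurable_increment r 0
          fun_prop
    _ ≤ ∑ j, ENNReal.ofReal ((r : ℝ) ^ (γ / β)) * m j :=
        Finset.sum_le_sum fun j _ =>
          (hX.levy.coord j).lintegral_increment_rpow_le hβ hγ (hX.isStrictlyStable_coord j)
            (hfin j).ne r
    _ = _ := by rw [← Finset.mul_sum, mul_comm]

end IsIsotropicStableProcess

/-! ### The passage time: measurability and finite mean -/

/-- The first passage time of a path, with the infimum taken over rational times and with value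
`⊤` if the path does not pass. -/
noncomputable def ratPassageTime (a t : ℝ) (f : ℝ≥0 → ℝ) : ENNReal :=
  ⨅ q : ℚ, if 0 < (q : ℝ).toNNReal ∧ t - f (q : ℝ).toNNReal < a then ((q : ℝ).toNNReal : ENNReal)
    else ⊤

theorem measurable_ratPassageTime (a t : ℝ) : Measurable (ratPassageTime a t) := by
  refine Measurable.iInf fun q => Measurable.ite ?_ measurable_const measurable_const
  by_cases hq : 0 < (q : ℝ).toNNReal
  · simp only [hq, true_and]
    exact measurableSet_lt (measurable_const.sub (measurable_pi_apply _)) measurable_const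
  · simp [hq]

/-- On a monotone path every rational after a passing time is itself passing, so rational times give
the same infimum. -/
theorem passageTime_eq_toNNReal_ratPassageTime {Ω : Type*} {τ : ℝ≥0 → Ω → ℝ} {a t : ℝ} {ω : Ω}
    (hω : Monotone fun s => τ s ω) :
    passageTime τ a t ω = (ratPassageTime a t fun s => τ s ω).toNNReal := by
  set S := {s : ℝ≥0 | 0 < s ∧ t - τ s ω < a}
  have hT : passageTime τ a t ω = sInf S := rfl
  rw [hT]
  rcases S.eq_empty_or_nonempty with he | hne
  -- If the path never passes, both sides take the default value: `sInf ∅ = 0` in `ℝ≥0` and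
  -- `⊤.toNNReal = 0`.
  · have : (ratPassageTime a t fun s => τ s ω) = ⊤ := by
      refine iInf_eq_top.2 fun q => if_neg fun hq => ?_
      have : (q : ℝ).toNNReal ∈ S := hq
      simp [he] at this
    rw [this, he]
    simp
  · have : (ratPassageTime a t fun s => τ s ω) = ((sInf S : ℝ≥0) : ENNReal) := by
      refine le_antisymm ?_ (le_iInf fun q => ?_)
      · refine le_of_forall_gt fun b hb => ?_
        obtain ⟨c, hc, hcb⟩ := ENNReal.lt_iff_exists_nnreal_btwn.1 hb
        rw [ENNReal.coe_lt_coe] at hc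
        obtain ⟨s, hs, hsc⟩ := exists_lt_of_csInf_lt hne hc
        obtain ⟨q, -, hq1, hq2⟩ := (NNReal.lt_iff_exists_rat_btwn _ _).1 hsc
        refine lt_of_le_of_lt (iInf_le _ q) ?_
        rw [if_pos ⟨hs.1.trans hq1, lt_of_le_of_lt (sub_le_sub_left (hω hq1.le) t) hs.2⟩]
        exact (ENNReal.coe_lt_coe.2 hq2).trans hcb
      · split_ifs with hq
        · exact ENNReal.coe_le_coe.2 (csInf_le (OrderBot.bddBelow _) hq)
        · exact le_top
    rw [this, ENNReal.toNNReal_coe]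

/-- The first integer `n` with `f n > t - a` bounds the passage time, and all `n` integers before it
contribute `1` to the sum. -/
theorem ratPassageTime_le_tsum {a t : ℝ} {f : ℝ≥0 → ℝ} (h0 : f 0 = 0) (hat : a < t) :
    ratPassageTime a t f ≤ ∑' n : ℕ, if f n ≤ t - a then 1 else 0 := by
  classical
  by_cases h : ∃ n : ℕ, t - a < f n
  · have hspec := Nat.find_spec h
    have hmin : ∀ m < Nat.find h, f m ≤ t - a := fun m hm => not_lt.1 (Nat.find_min h hm)
    set n := Nat.find h
    have hn : n ≠ 0 := by
      intro hn
      rw [hn, Nat.cast_zero, h0] at hspec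
      linarith
    calc ratPassageTime a t f ≤ (n : ENNReal) := by
          refine (iInf_le _ (n : ℚ)).trans ?_
          have hcast : (((n : ℚ) : ℝ)).toNNReal = (n : ℝ≥0) := by simp
          rw [hcast, if_pos ⟨by positivity, by linarith⟩]
          simp
      _ = ∑ m ∈ Finset.range n, if f m ≤ t - a then 1 else 0 := by
          rw [Finset.sum_congr rfl fun m hm => if_pos (hmin m (Finset.mem_range.1 hm))]
          simp
      _ ≤ _ := ENNReal.sum_le_tsum _
  · push Not at h
    simp [h]

namespace IsStableSubordinator

variable {Ω : Type*} [MeasurableSpace Ω] {P : Measure Ω} {α : ℝ}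
  {τ : ℝ≥0 → Ω → ℝ}

theorem lintegral_exp_neg_one (hτ : IsStableSubordinator α τ P) :
    ∫⁻ ω, ENNReal.ofReal (Real.exp (-(τ 1 ω - τ 0 ω))) ∂P = ENNReal.ofReal (Real.exp (-1)) := by
  have h1 := hτ.laplace 1 zero_le_one
  rw [Real.one_rpow] at h1
  -- Without integrability the Bochner integral would be `0`, not `exp (-1)`.
  have hint : Integrable (fun ω => Real.exp (-1 * τ 1 ω)) P := by
    by_contra h
    rw [integral_undef h] at h1
    exact (Real.exp_pos _).ne h1
  rw [← h1, ofReal_integral_eq_lintegral_ofReal hint (Eventually.of_forall fun _ => by positivity)]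
  refine lintegral_congr_ae ?_
  filter_upwards [hτ.start] with ω hω
  simp [hω]

theorem lintegral_exp_neg_nat (hτ : IsStableSubordinator α τ P) [IsProbabilityMeasure P] (n : ℕ) :
    ∫⁻ ω, ENNReal.ofReal (Real.exp (-(τ n ω - τ 0 ω))) ∂P = ENNReal.ofReal (Real.exp (-1)) ^ n := by
  have hmeas : Measurable fun y : ℝ => ENNReal.ofReal (Real.exp (-y)) := by fun_prop
  induction n with
  | zero => simp
  | succ k ih =>
    have hind : IndepFun (fun ω => τ k ω - τ 0 ω) (fun ω => τ (k + 1) ω - τ k ω) P :=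
      hτ.levy.indep_increments.indepFun_sub_sub (zero_le (a := (k : ℝ≥0))) le_self_add
    have h := lintegral_mul_eq_lintegral_mul_lintegral_of_indepFun
      (hmeas.comp (hτ.levy.measurable_increment k 0))
      (hmeas.comp (hτ.levy.measurable_increment (k + 1) k)) (hind.comp hmeas hmeas)
    have hs := ((hτ.levy.stationary_increments k 1).comp hmeas).lintegral_eq
    simp only [Function.comp_def, Pi.mul_apply] at h hs
    rw [hs, ih, hτ.lintegral_exp_neg_one, ← pow_succ] at h
    rw [← h]
    congr 1
    funext ω
    rw [← ENNReal.ofReal_mul (by positivity), ← Real.exp_add]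
    push_cast
    congr 2
    ring

/-- Exponential Markov inequality: the indicator of `τ n ≤ c` is at most `exp (c - τ n)`. -/
theorem measure_le_le (hτ : IsStableSubordinator α τ P) [IsProbabilityMeasure P] (c : ℝ) (n : ℕ) :
    P {ω | τ n ω ≤ c} ≤ ENNReal.ofReal (Real.exp c) * ENNReal.ofReal (Real.exp (-1)) ^ n := by
  have hm := hτ.levy.measurable n
  rw [← hτ.lintegral_exp_neg_nat n, ← lintegral_const_mul _ (by
    have := hτ.levy.measurable_increment n 0
    fun_prop), ← lintegral_indicator_one (measurableSet_le hm measurable_const)]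
  refine lintegral_mono_ae ?_
  filter_upwards [hτ.start] with ω hω
  by_cases h : τ n ω ≤ c
  · rw [Set.indicator_of_mem (by exact h), ← ENNReal.ofReal_mul (by positivity), ← Real.exp_add,
      Pi.one_apply, ENNReal.one_le_ofReal, hω]
    exact Real.one_le_exp (by linarith)
  · rw [Set.indicator_of_notMem (by exact h)]
    exact zero_le

theorem lintegral_ratPassageTime_lt_top (hτ : IsStableSubordinator α τ P) [IsProbabilityMeasure P]
    {a t : ℝ} (hat : a < t) : ∫⁻ ω, ratPassageTime a t (fun s => τ s ω) ∂P < ⊤ := by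
  have hms : ∀ n : ℕ, MeasurableSet {ω | τ n ω ≤ t - a} := fun n =>
    measurableSet_le (hτ.levy.measurable n) measurable_const
  have hr : ENNReal.ofReal (Real.exp (-1)) < 1 := by
    rw [ENNReal.ofReal_lt_one]
    simp
  calc ∫⁻ ω, ratPassageTime a t (fun s => τ s ω) ∂P
      ≤ ∫⁻ ω, ∑' n : ℕ, (if τ n ω ≤ t - a then 1 else 0) ∂P := by
        refine lintegral_mono_ae ?_
        filter_upwards [hτ.start] with ω hω using ratPassageTime_le_tsum hω hat
    _ = ∑' n : ℕ, P {ω | τ n ω ≤ t - a} := by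
        rw [lintegral_tsum fun n =>
          (Measurable.ite (hms n) measurable_const measurable_const).aemeasurable]
        refine tsum_congr fun n => ?_
        rw [← lintegral_indicator_one (hms n)]
        rfl
    _ ≤ ∑' n : ℕ, ENNReal.ofReal (Real.exp (t - a)) * ENNReal.ofReal (Real.exp (-1)) ^ n :=
        ENNReal.tsum_le_tsum fun n => hτ.measure_le_le (t - a) n
    _ < ⊤ := by
        rw [ENNReal.tsum_mul_left, ENNReal.tsum_geometric]
        refine ENNReal.mul_lt_top ENNReal.ofReal_lt_top (ENNReal.inv_lt_top.2 ?_)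
        exact tsub_pos_of_lt hr

end IsStableSubordinator

/-! ### Joint measurability and averaging over an independent time -/

/-- By right-continuity the process is an almost everywhere limit of processes evaluated on a
countable grid, which are jointly measurable. -/
theorem IsLevyProcess.aemeasurable_uncurry {Ω E : Type*} [MeasurableSpace Ω]
    [NormedAddCommGroup E] [MeasurableSpace E] [BorelSpace E] {X : ℝ≥0 → Ω → E} {P : Measure Ω}
    [SFinite P] (hX : IsLevyProcess X P) :
    AEMeasurable (fun p : Ω × ℝ => X p.2.toNNReal p.1) (P.prod volume) := by
  refine aemeasurable_of_tendsto_metrizable_ae atTop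
    (f := fun n (p : Ω × ℝ) => X (gridSucc n p.2.toNNReal) p.1) (fun n => ?_) ?_
  · have h1 : Measurable fun p : Ω × ℕ => X (((p.2 + 1 : ℕ) : ℝ≥0) / (n + 1 : ℕ)) p.1 :=
      measurable_from_prod_countable_left fun k =>
        hX.measurable (((k + 1 : ℕ) : ℝ≥0) / (n + 1 : ℕ))
    have h2 : Measurable fun p : Ω × ℝ => (p.1, ⌊((n : ℝ≥0) + 1) * p.2.toNNReal⌋₊) :=
      measurable_fst.prodMk (Nat.measurable_floor.comp (by fun_prop))
    exact (h1.comp h2).aemeasurable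
  · filter_upwards [Measure.quasiMeasurePreserving_fst.ae hX.cadlag] with p hp
    exact (hp p.2.toNNReal).1.tendsto.comp (tendsto_gridSucc _)

/-- After Tonelli, independence is needed only at each fixed `s`. The weight `k` will be the
indicator of a range of integration with random end points. -/
theorem lintegral_lintegral_mul_le_of_indepFun {Ω S : Type*} [MeasurableSpace Ω]
    [MeasurableSpace S] {P : Measure Ω} [SFinite P] {T : Ω → S} (hT : Measurable T)
    {F : Ω → ℝ → ENNReal}
    (hF : AEMeasurable (Function.uncurry F) (P.prod volume)) (hFs : ∀ s, Measurable fun ω => F ω s)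
    (hind : ∀ s, IndepFun T (fun ω => F ω s) P) {c : ℝ → ENNReal} (hc : Measurable c)
    (hFc : ∀ s, ∫⁻ ω, F ω s ∂P ≤ c s) {k : S → ℝ → ENNReal} (hk : Measurable (Function.uncurry k)) :
    ∫⁻ ω, (∫⁻ s, k (T ω) s * F ω s) ∂P ≤ ∫⁻ ω, (∫⁻ s, k (T ω) s * c s) ∂P := by
  have hkT : Measurable fun p : Ω × ℝ => k (T p.1) p.2 :=
    hk.comp ((hT.comp measurable_fst).prodMk measurable_snd)
  have hks : ∀ s, Measurable fun ω => k (T ω) s := fun s => hkT.comp measurable_prodMk_right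
  have hswap : ∫⁻ ω, (∫⁻ s, k (T ω) s * c s) ∂P = ∫⁻ s, ∫⁻ ω, k (T ω) s * c s ∂P :=
    lintegral_lintegral_swap (hkT.mul (hc.comp measurable_snd)).aemeasurable
  rw [lintegral_lintegral_swap (hkT.aemeasurable.mul hF), hswap]
  refine lintegral_mono fun s => ?_
  have hi : IndepFun (fun ω => k (T ω) s) (fun ω => F ω s) P :=
    (hind s).comp (φ := fun y => k y s) (hk.comp measurable_prodMk_right) measurable_id
  have h := lintegral_mul_eq_lintegral_mul_lintegral_of_indepFun (hks s) (hFs s) hi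
  simp only [Pi.mul_apply] at h
  rw [h, lintegral_mul_const _ (hks s)]
  gcongr
  exact hFc s

/-! ### Riemann sums and deterministic estimates -/

/-- The left end point of the interval `(i h, (i + 1) h]` which contains `s`. -/
noncomputable def gridPred (h s : ℝ) : ℝ≥0 := (((⌈s / h⌉₊ : ℝ) - 1) * h).toNNReal

theorem gridPred_of_mem_Ioc {h s : ℝ} (hh : 0 < h) {k : ℕ}
    (hs : s ∈ Set.Ioc (k * h) ((k + 1 : ℕ) * h)) :
    gridPred h s = (k * h).toNNReal := by
  have : ⌈s / h⌉₊ = k + 1 := by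
    rw [Nat.ceil_eq_iff (Nat.succ_ne_zero k), div_le_iff₀ hh, lt_div_iff₀ hh]
    simpa using hs
  rw [gridPred, this]
  push_cast
  rw [add_sub_cancel_right]

theorem gridPred_le {h s : ℝ} (hh : 0 < h) : gridPred h s ≤ s.toNNReal := by
  rcases le_or_gt s 0 with hs | hs
  · have : ⌈s / h⌉₊ = 0 := Nat.ceil_eq_zero.2 (div_nonpos_of_nonpos_of_nonneg hs hh.le)
    rw [gridPred, this, Real.toNNReal_of_nonpos]
    · exact zero_le
    · push_cast; linarith
  · refine Real.toNNReal_le_toNNReal ?_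
    rw [← le_div_iff₀ hh]
    linarith [Nat.ceil_lt_add_one (a := s / h) (by positivity)]

theorem toNNReal_sub_gridPred_le {h s : ℝ} (hh : 0 < h) :
    ((s.toNNReal - gridPred h s : ℝ≥0) : ℝ) ≤ h := by
  have h1 : s ≤ ((⌈s / h⌉₊ : ℝ) - 1) * h + h := by
    have := (div_le_iff₀ hh).1 (Nat.le_ceil (s / h))
    linarith
  have h2 : s.toNNReal ≤ gridPred h s + h.toNNReal :=
    (Real.toNNReal_le_toNNReal h1).trans Real.toNNReal_add_le
  have h3 : s.toNNReal - gridPred h s ≤ h.toNNReal := tsub_le_iff_left.2 h2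
  simpa [hh.le] using NNReal.coe_le_coe.2 h3

/-- The integrand is constant on each cell `(k h, (k+1) h]`, so no regularity of `g` or `p` is
needed. -/
theorem sum_eq_integral_gridPred {E : Type*} (g : E → ℝ) (p : ℝ≥0 → E) {h : ℝ} (hh : 0 < h)
    (N : ℕ) :
    IntervalIntegrable (fun s => g (p (gridPred h s))) volume 0 (N * h) ∧
      ∑ i ∈ Finset.Icc 1 N, h * g (p (((i : ℝ) - 1) * h).toNNReal) =
        ∫ s in (0 : ℝ)..(N * h), g (p (gridPred h s)) := by
  induction N with
  | zero => simp
  | succ k ih =>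
    obtain ⟨ih1, ih2⟩ := ih
    have hle : (k : ℝ) * h ≤ (k + 1 : ℕ) * h := by push_cast; nlinarith
    have hcongr : Set.EqOn (fun _ => g (p (k * h).toNNReal)) (fun s => g (p (gridPred h s)))
        (Set.uIoc (k * h) ((k + 1 : ℕ) * h)) := by
      intro s hs
      rw [Set.uIoc_of_le hle] at hs
      simp only [gridPred_of_mem_Ioc hh hs]
    have hint : IntervalIntegrable (fun s => g (p (gridPred h s))) volume (k * h)
        ((k + 1 : ℕ) * h) :=
      (intervalIntegrable_const (μ := volume)).congr hcongr
    refine ⟨ih1.trans hint, ?_⟩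
    rw [← intervalIntegral.integral_add_adjacent_intervals ih1 hint,
      Finset.sum_Icc_succ_top (by omega), ih2]
    congr 1
    rw [← intervalIntegral.integral_congr_ae (Eventually.of_forall hcongr),
      intervalIntegral.integral_const]
    push_cast
    simp only [add_sub_cancel_right, smul_eq_mul]
    ring

theorem continuous_of_abs_sub_le_gammaNorm {d : ℕ} {γ L : ℝ} (hγ : 0 < γ)
    {g : EuclideanSpace ℝ (Fin d) → ℝ} (hg : ∀ y z, |g y - g z| ≤ L * gammaNorm γ (y - z)) :
    Continuous g := by
  refine continuous_iff_continuousAt.2 fun y => tendsto_iff_dist_tendsto_zero.2 ?_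
  refine squeeze_zero (fun _ => dist_nonneg) (fun z => hg z y) ?_
  have hc : Continuous fun z => L * gammaNorm γ (z - y) := by
    unfold gammaNorm
    refine continuous_const.mul (continuous_finsetSum _ fun j _ => ?_)
    have : Continuous fun z : EuclideanSpace ℝ (Fin d) => |(z - y) j| := by fun_prop
    exact this.rpow_const fun _ => Or.inr hγ.le
  simpa [gammaNorm, Real.zero_rpow hγ.ne'] using hc.tendsto y

theorem gammaNorm_nonneg {d : ℕ} (γ : ℝ) (y : EuclideanSpace ℝ (Fin d)) : 0 ≤ gammaNorm γ y :=
  Finset.sum_nonneg fun _ _ => by positivity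

/-- `N h` for the largest integer `N` with `N h ≤ T`. -/
noncomputable def gridFloor (h : ℝ) (T : ℝ≥0) : ℝ := ⌊(T : ℝ) / h⌋₊ * h

theorem gridFloor_nonneg {h : ℝ} (hh : 0 < h) (T : ℝ≥0) : 0 ≤ gridFloor h T := by
  unfold gridFloor; positivity

theorem gridFloor_le {h : ℝ} (hh : 0 < h) (T : ℝ≥0) : gridFloor h T ≤ T :=
  (le_div_iff₀ hh).1 (Nat.floor_le (by positivity))

theorem measurable_gridFloor (h : ℝ) : Measurable (gridFloor h) := by
  have : Measurable fun T : ℝ≥0 => ⌊(T : ℝ) / h⌋₊ := Nat.measurable_floor.comp (by fun_prop)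
  exact ((measurable_from_top (f := fun n : ℕ => (n : ℝ))).comp this).mul_const h

/-- The remainder is at most both `h` and `T`; interpolating the two bounds extracts exactly `h^θ`.
-/
theorem sub_gridFloor_le {h θ : ℝ} (hh : 0 < h) (hθ : 0 ≤ θ) (hθ1 : θ ≤ 1) (T : ℝ≥0) :
    (T : ℝ) - gridFloor h T ≤ h ^ θ * (T : ℝ) ^ (1 - θ) := by
  have h0 : 0 ≤ (T : ℝ) - gridFloor h T := sub_nonneg.2 (gridFloor_le hh T)
  have h1 : (T : ℝ) - gridFloor h T ≤ h := by
    have := (div_le_iff₀ hh).1 (Nat.lt_floor_add_one ((T : ℝ) / h)).le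
    rw [gridFloor]; linarith
  have h2 : (T : ℝ) - gridFloor h T ≤ T := by linarith [gridFloor_nonneg hh T]
  calc (T : ℝ) - gridFloor h T
      = ((T : ℝ) - gridFloor h T) ^ θ * ((T : ℝ) - gridFloor h T) ^ (1 - θ) := by
        rw [← Real.rpow_add_of_nonneg h0 hθ (by linarith), add_sub_cancel, Real.rpow_one]
    _ ≤ h ^ θ * (T : ℝ) ^ (1 - θ) := by
        gcongr

/-- The powers `1 - θ` and `θ` recombine to `T`, so a first moment of `T` suffices for the last
piece. -/
theorem rpow_mul_add_le {θ A B T : ℝ} (hθ : 0 ≤ θ) (hθ1 : θ < 1) (hA : 0 ≤ A) (hT : 0 ≤ T) :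
    T ^ (1 - θ) * (A + B * T ^ θ) ≤ A * (1 + T) + B * T := by
  have h1 : T ^ (1 - θ) ≤ 1 + T := by
    rcases le_or_gt T 1 with h | h
    · linarith [Real.rpow_le_one hT h (by linarith : 0 ≤ 1 - θ)]
    · linarith [(Real.rpow_le_rpow_of_exponent_le h.le (by linarith : 1 - θ ≤ 1)).trans_eq
        (Real.rpow_one T)]
  have h2 : T ^ (1 - θ) * T ^ θ = T := by
    rw [← Real.rpow_add_of_nonneg hT (by linarith) hθ, sub_add_cancel, Real.rpow_one]
  calc T ^ (1 - θ) * (A + B * T ^ θ) = A * T ^ (1 - θ) + B * (T ^ (1 - θ) * T ^ θ) := by ring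
    _ ≤ A * (1 + T) + B * T := by rw [h2]; gcongr

theorem measurableSet_gridFloor (h : ℝ) :
    MeasurableSet {p : ℝ≥0 × ℝ | p.2 ∈ Set.Ioc 0 (gridFloor h p.1)} :=
  (measurableSet_lt measurable_const measurable_snd).inter
    (measurableSet_le measurable_snd ((measurable_gridFloor h).comp measurable_fst))

theorem lintegral_indicator_one_mul {S : Type*} [MeasurableSpace S] {μ : Measure S} {A : Set S}
    (hA : MeasurableSet A) (f : S → ENNReal) :
    ∫⁻ s, A.indicator 1 s * f s ∂μ = ∫⁻ s in A, f s ∂μ := by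
  rw [← lintegral_indicator hA]
  congr 1
  funext s
  by_cases hs : s ∈ A <;> simp [hs]

theorem enorm_integral_sub_le {f f' : ℝ → ℝ} {a b : ℝ} (ha : 0 ≤ a) (hab : a ≤ b)
    (hf : IntervalIntegrable f volume 0 b) (hf' : IntervalIntegrable f' volume 0 a) :
    ‖(∫ s in (0 : ℝ)..b, f s) - ∫ s in (0 : ℝ)..a, f' s‖ₑ ≤
      (∫⁻ s in Set.Ioc 0 a, ‖f s - f' s‖ₑ) + ∫⁻ s in Set.Ioc a b, ‖f s‖ₑ := by
  have hfa : IntervalIntegrable f volume 0 a := hf.mono_set (by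
    rw [Set.uIcc_of_le ha, Set.uIcc_of_le (ha.trans hab)]; exact Set.Icc_subset_Icc_right hab)
  have hfab : IntervalIntegrable f volume a b := hf.mono_set (by
    rw [Set.uIcc_of_le hab, Set.uIcc_of_le (ha.trans hab)]; exact Set.Icc_subset_Icc_left ha)
  have heq : (∫ s in (0 : ℝ)..b, f s) - ∫ s in (0 : ℝ)..a, f' s =
      (∫ s in (0 : ℝ)..a, (f s - f' s)) + ∫ s in a..b, f s := by
    rw [intervalIntegral.integral_sub hfa hf',
      ← intervalIntegral.integral_add_adjacent_intervals hfa hfab]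
    ring
  rw [heq, intervalIntegral.integral_of_le ha, intervalIntegral.integral_of_le hab]
  exact (enorm_add_le _ _).trans
    (add_le_add (enorm_integral_le_lintegral_enorm _) (enorm_integral_le_lintegral_enorm _))

/-! ### Error estimate at an independent random time -/

/-- The setting of the error estimate: the increments of `X` have `γ`-moments which grow like
`r ^ θ`, and `T` is an integrable random time independent of `X`. -/
structure RandomTimeSetting {Ω : Type*} [MeasurableSpace Ω] (P : Measure Ω) {d : ℕ}
    (γ θ K L : ℝ) (x : EuclideanSpace ℝ (Fin d)) (X : ℝ≥0 → Ω → EuclideanSpace ℝ (Fin d))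
    (T : Ω → ℝ≥0) (g : EuclideanSpace ℝ (Fin d) → ℝ) : Prop where
  levy : IsLevyProcess X P
  start : ∀ᵐ ω ∂P, X 0 ω = x
  moment : ∀ s r : ℝ≥0, ∫⁻ ω, ENNReal.ofReal (gammaNorm γ (X (s + r) ω - X s ω)) ∂P ≤
    ENNReal.ofReal (K * (r : ℝ) ^ θ)
  measurable_time : Measurable T
  indep : IndepFun T (fun ω s => X s ω) P
  lintegral_time : ∫⁻ ω, (T ω : ENNReal) ∂P ≠ ⊤
  continuous : Continuous g
  holder : ∀ y z, |g y - g z| ≤ L * gammaNorm γ (y - z)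
  pos : 0 < θ
  lt_one : θ < 1
  nonneg_moment : 0 ≤ K
  nonneg_holder : 0 ≤ L

namespace RandomTimeSetting

variable {Ω : Type*} [MeasurableSpace Ω] {P : Measure Ω} {d : ℕ}
  {γ θ K L : ℝ} {x : EuclideanSpace ℝ (Fin d)} {X : ℝ≥0 → Ω → EuclideanSpace ℝ (Fin d)}
  {T : Ω → ℝ≥0} {g : EuclideanSpace ℝ (Fin d) → ℝ}

theorem lintegral_enorm_sub_le (H : RandomTimeSetting P γ θ K L x X T g) (s r : ℝ≥0) :
    ∫⁻ ω, ‖g (X (s + r) ω) - g (X s ω)‖ₑ ∂P ≤ ENNReal.ofReal (L * K * (r : ℝ) ^ θ) := by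
  have hgm : Measurable fun y : EuclideanSpace ℝ (Fin d) => ENNReal.ofReal (gammaNorm γ y) := by
    unfold gammaNorm; fun_prop
  calc ∫⁻ ω, ‖g (X (s + r) ω) - g (X s ω)‖ₑ ∂P
      ≤ ∫⁻ ω, ENNReal.ofReal L * ENNReal.ofReal (gammaNorm γ (X (s + r) ω - X s ω)) ∂P := by
        refine lintegral_mono fun ω => ?_
        rw [← ENNReal.ofReal_mul H.nonneg_holder, Real.enorm_eq_ofReal_abs]
        exact ENNReal.ofReal_le_ofReal (H.holder _ _)
    _ = ENNReal.ofReal L * ∫⁻ ω, ENNReal.ofReal (gammaNorm γ (X (s + r) ω - X s ω)) ∂P :=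
        lintegral_const_mul _ (hgm.comp ((H.levy.measurable _).sub (H.levy.measurable _)))
    _ ≤ ENNReal.ofReal L * ENNReal.ofReal (K * (r : ℝ) ^ θ) := by gcongr; exact H.moment s r
    _ = _ := by rw [← ENNReal.ofReal_mul H.nonneg_holder, mul_assoc]

theorem measurable_gridPred_uncurry (H : RandomTimeSetting P γ θ K L x X T g) (h : ℝ) :
    Measurable (fun p : Ω × ℝ => g (X (gridPred h p.2) p.1)) := by
  have h1 : Measurable fun p : Ω × ℕ => X (((p.2 : ℝ) - 1) * h).toNNReal p.1 :=
    measurable_from_prod_countable_left fun k => H.levy.measurable (((k : ℝ) - 1) * h).toNNReal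
  have h2 : Measurable fun p : Ω × ℝ => (p.1, ⌈p.2 / h⌉₊) :=
    measurable_fst.prodMk (Nat.measurable_ceil.comp (by fun_prop))
  have h3 : Measurable fun p : Ω × ℝ => X (gridPred h p.2) p.1 := by
    simpa only [gridPred, Function.comp_def] using h1.comp h2
  exact H.continuous.measurable.comp h3

theorem measurable_eval (H : RandomTimeSetting P γ θ K L x X T g) (s : ℝ≥0) :
    Measurable fun ω => g (X s ω) :=
  H.continuous.measurable.comp (H.levy.measurable s)

theorem measurable_comp_eval (H : RandomTimeSetting P γ θ K L x X T g) (s : ℝ≥0) :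
    Measurable fun p : ℝ≥0 → EuclideanSpace ℝ (Fin d) => g (p s) :=
  H.continuous.measurable.comp (measurable_pi_apply s)

theorem lintegral_enorm_sub_gridPred_le (H : RandomTimeSetting P γ θ K L x X T g) {h : ℝ}
    (hh : 0 < h) (s : ℝ) :
    ∫⁻ ω, ‖g (X s.toNNReal ω) - g (X (gridPred h s) ω)‖ₑ ∂P ≤
      ENNReal.ofReal (L * K * h ^ θ) := by
  have hK := H.nonneg_moment
  have hL := H.nonneg_holder
  have hθ := H.pos
  have h1 := H.lintegral_enorm_sub_le (gridPred h s) (s.toNNReal - gridPred h s)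
  rw [add_tsub_cancel_of_le (gridPred_le hh)] at h1
  refine h1.trans (ENNReal.ofReal_le_ofReal ?_)
  gcongr
  exact toNNReal_sub_gridPred_le hh

variable [IsProbabilityMeasure P]

theorem lintegral_enorm_le (H : RandomTimeSetting P γ θ K L x X T g) (s : ℝ≥0) :
    ∫⁻ ω, ‖g (X s ω)‖ₑ ∂P ≤ ENNReal.ofReal (|g x| + L * K * (s : ℝ) ^ θ) := by
  have hK := H.nonneg_moment
  have hL := H.nonneg_holder
  have h0 := H.lintegral_enorm_sub_le 0 s
  rw [zero_add] at h0
  rw [ENNReal.ofReal_add (abs_nonneg _) (by positivity)]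
  calc ∫⁻ ω, ‖g (X s ω)‖ₑ ∂P
      ≤ ∫⁻ ω, (ENNReal.ofReal |g x| + ‖g (X s ω) - g (X 0 ω)‖ₑ) ∂P := by
        refine lintegral_mono_ae ?_
        filter_upwards [H.start] with ω hω
        rw [hω, ← Real.enorm_eq_ofReal_abs]
        have := enorm_add_le (g x) (g (X s ω) - g x)
        rwa [add_sub_cancel] at this
    _ = ENNReal.ofReal |g x| + ∫⁻ ω, ‖g (X s ω) - g (X 0 ω)‖ₑ ∂P := by
        rw [lintegral_add_left measurable_const, lintegral_const, measure_univ, mul_one]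
    _ ≤ _ := by gcongr

theorem aemeasurable_uncurry (H : RandomTimeSetting P γ θ K L x X T g) :
    AEMeasurable (fun p : Ω × ℝ => g (X p.2.toNNReal p.1)) (P.prod volume) :=
  H.continuous.measurable.comp_aemeasurable H.levy.aemeasurable_uncurry

theorem lintegral_lintegral_mul_sub_le (H : RandomTimeSetting P γ θ K L x X T g) {h : ℝ}
    (hh : 0 < h) {k : ℝ≥0 → ℝ → ENNReal} (hk : Measurable (Function.uncurry k)) :
    ∫⁻ ω, (∫⁻ s, k (T ω) s * ‖g (X s.toNNReal ω) - g (X (gridPred h s) ω)‖ₑ) ∂P ≤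
      ∫⁻ ω, (∫⁻ s, k (T ω) s * ENNReal.ofReal (L * K * h ^ θ)) ∂P :=
  lintegral_lintegral_mul_le_of_indepFun H.measurable_time
    (F := fun ω s => ‖g (X s.toNNReal ω) - g (X (gridPred h s) ω)‖ₑ)
    (H.aemeasurable_uncurry.sub (H.measurable_gridPred_uncurry h).aemeasurable).enorm
    (fun _ => ((H.measurable_eval _).sub (H.measurable_eval _)).enorm)
    (fun s => H.indep.comp measurable_id
      (((H.measurable_comp_eval s.toNNReal).sub (H.measurable_comp_eval (gridPred h s))).enorm))
    measurable_const (fun s => H.lintegral_enorm_sub_gridPred_le hh s) hk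

theorem lintegral_lintegral_mul_le (H : RandomTimeSetting P γ θ K L x X T g)
    {k : ℝ≥0 → ℝ → ENNReal} (hk : Measurable (Function.uncurry k)) :
    ∫⁻ ω, (∫⁻ s, k (T ω) s * ‖g (X s.toNNReal ω)‖ₑ) ∂P ≤
      ∫⁻ ω, (∫⁻ s, k (T ω) s * ENNReal.ofReal (|g x| + L * K * (s.toNNReal : ℝ) ^ θ)) ∂P :=
  lintegral_lintegral_mul_le_of_indepFun H.measurable_time
    (F := fun ω s => ‖g (X s.toNNReal ω)‖ₑ)
    H.aemeasurable_uncurry.enorm (fun _ => (H.measurable_eval _).enorm)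
    (fun s => H.indep.comp measurable_id (H.measurable_comp_eval s.toNNReal).enorm)
    (by fun_prop) (fun s => H.lintegral_enorm_le s.toNNReal) hk

/-- The mean of `∫ |g(X_s)| ds` over `(0, n]` is finite for each integer `n`. One null set then
serves every `b`, which is needed because `b` will be the random `T ω`. -/
theorem ae_intervalIntegrable (H : RandomTimeSetting P γ θ K L x X T g) :
    ∀ᵐ ω ∂P, ∀ b : ℝ≥0, IntervalIntegrable (fun s => g (X s.toNNReal ω)) volume 0 b := by
  have hK := H.nonneg_moment
  have hL := H.nonneg_holder
  have hθ := H.pos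
  have key : ∀ n : ℕ, ∀ᵐ ω ∂P, ∫⁻ s in Set.Ioc (0 : ℝ) n, ‖g (X s.toNNReal ω)‖ₑ < ⊤ := by
    intro n
    have hms : MeasurableSet (Set.Ioc (0 : ℝ) n) := measurableSet_Ioc
    have hi : Measurable ((Set.Ioc (0 : ℝ) n).indicator (1 : ℝ → ENNReal)) :=
      measurable_one.indicator hms
    simp only [← lintegral_indicator_one_mul hms]
    refine ae_lt_top' ?_ (ne_of_lt ?_)
    · exact AEMeasurable.lintegral_prod_right'
        (f := fun p : Ω × ℝ => (Set.Ioc (0 : ℝ) n).indicator 1 p.2 * ‖g (X p.2.toNNReal p.1)‖ₑ)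
        ((hi.comp measurable_snd).aemeasurable.mul H.aemeasurable_uncurry.enorm)
    · refine (H.lintegral_lintegral_mul_le (k := fun _ s => (Set.Ioc (0 : ℝ) n).indicator 1 s)
        (hi.comp measurable_snd)).trans_lt ?_
      rw [lintegral_const, measure_univ, mul_one]
      calc ∫⁻ s, (Set.Ioc (0 : ℝ) n).indicator 1 s *
              ENNReal.ofReal (|g x| + L * K * (s.toNNReal : ℝ) ^ θ)
          ≤ ∫⁻ s, (Set.Ioc (0 : ℝ) n).indicator
              (fun _ => ENNReal.ofReal (|g x| + L * K * (n : ℝ) ^ θ)) s := by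
            refine lintegral_mono fun s => ?_
            by_cases hs : s ∈ Set.Ioc (0 : ℝ) n
            · simp only [hs, Set.indicator_of_mem, Pi.one_apply, one_mul]
              rw [Real.coe_toNNReal _ hs.1.le]
              have := hs.2
              have := hs.1.le
              gcongr
            · simp [hs]
        _ < ⊤ := by
            rw [lintegral_indicator hms, lintegral_const, Measure.restrict_apply_univ,
              Real.volume_Ioc]
            exact ENNReal.mul_lt_top ENNReal.ofReal_lt_top ENNReal.ofReal_lt_top
  filter_upwards [ae_all_iff.2 key, H.aemeasurable_uncurry.aestronglyMeasurable.prodMk_left]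
    with ω hω hm b
  obtain ⟨n, hn⟩ := exists_nat_ge (b : ℝ)
  rw [intervalIntegrable_iff_integrableOn_Ioc_of_le b.coe_nonneg]
  have : IntegrableOn (fun s => g (X s.toNNReal ω)) (Set.Ioc 0 (n : ℝ)) volume :=
    ⟨hm.restrict, hω n⟩
  exact this.mono_set (Set.Ioc_subset_Ioc_right hn)

end RandomTimeSetting

namespace RandomTimeSetting

variable {Ω : Type*} [MeasurableSpace Ω] {P : Measure Ω} [IsProbabilityMeasure P] {d : ℕ}
  {γ θ K L : ℝ} {x : EuclideanSpace ℝ (Fin d)} {X : ℝ≥0 → Ω → EuclideanSpace ℝ (Fin d)}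
  {T : Ω → ℝ≥0} {g : EuclideanSpace ℝ (Fin d) → ℝ}

theorem aestronglyMeasurable_error (H : RandomTimeSetting P γ θ K L x X T g) {h : ℝ}
    (hh : 0 < h) :
    AEStronglyMeasurable (fun ω => (∫ s in (0 : ℝ)..(T ω : ℝ), g (X s.toNNReal ω)) -
      ∫ s in (0 : ℝ)..gridFloor h (T ω), g (X (gridPred h s) ω)) P := by
  -- The random upper limit is absorbed into an indicator on `Ω × ℝ`, so that Fubini measurability
  -- applies.
  have key : ∀ (b : Ω → ℝ), Measurable b → (∀ ω, 0 ≤ b ω) → ∀ f : Ω × ℝ → ℝ,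
      AEStronglyMeasurable f (P.prod volume) →
      AEStronglyMeasurable (fun ω => ∫ s in (0 : ℝ)..b ω, f (ω, s)) P := by
    intro b hb hb0 f hf
    have hS : MeasurableSet {p : Ω × ℝ | p.2 ∈ Set.Ioc 0 (b p.1)} :=
      (measurableSet_lt measurable_const measurable_snd).inter
        (measurableSet_le measurable_snd (hb.comp measurable_fst))
    refine (hf.indicator hS).integral_prod_right'.congr (Eventually.of_forall fun ω => ?_)
    simp only
    rw [intervalIntegral.integral_of_le (hb0 ω), ← integral_indicator measurableSet_Ioc]
    rfl
  refine AEStronglyMeasurable.sub ?_ ?_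
  · exact key _ H.measurable_time.coe_nnreal_real (fun ω => (T ω).coe_nonneg) _
      H.aemeasurable_uncurry.aestronglyMeasurable
  · exact key _ ((measurable_gridFloor h).comp H.measurable_time)
      (fun ω => gridFloor_nonneg hh _) _
      (H.measurable_gridPred_uncurry h).aestronglyMeasurable

theorem aemeasurable_sub_part (H : RandomTimeSetting P γ θ K L x X T g) (h : ℝ) :
    AEMeasurable (fun ω => ∫⁻ s in Set.Ioc 0 (gridFloor h (T ω)),
        ‖g (X s.toNNReal ω) - g (X (gridPred h s) ω)‖ₑ) P := by
  have hf := (H.aemeasurable_uncurry.sub (H.measurable_gridPred_uncurry h).aemeasurable).enorm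
  have hS : MeasurableSet {p : Ω × ℝ | p.2 ∈ Set.Ioc 0 (gridFloor h (T p.1))} :=
    ((H.measurable_time.comp measurable_fst).prodMk measurable_snd) (measurableSet_gridFloor h)
  refine (hf.indicator hS).lintegral_prod_right'.congr (Eventually.of_forall fun ω => ?_)
  simp only
  rw [← lintegral_indicator measurableSet_Ioc]
  rfl

theorem lintegral_sub_part_le (H : RandomTimeSetting P γ θ K L x X T g) {h : ℝ} (hh : 0 < h) :
    ∫⁻ ω, (∫⁻ s in Set.Ioc 0 (gridFloor h (T ω)),
        ‖g (X s.toNNReal ω) - g (X (gridPred h s) ω)‖ₑ) ∂P ≤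
      ∫⁻ ω, ENNReal.ofReal (h ^ θ * (L * K * T ω)) ∂P := by
  have hK := H.nonneg_moment
  have hL := H.nonneg_holder
  have hS := measurableSet_gridFloor h
  have hmain := H.lintegral_lintegral_mul_sub_le hh
    (k := fun T s => (Set.Ioc 0 (gridFloor h T)).indicator 1 s) (measurable_one.indicator hS)
  simp only [lintegral_indicator_one_mul measurableSet_Ioc, setLIntegral_const, Real.volume_Ioc,
    sub_zero] at hmain
  refine hmain.trans (lintegral_mono fun ω => ?_)
  rw [← ENNReal.ofReal_mul (by positivity)]
  refine ENNReal.ofReal_le_ofReal ?_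
  calc L * K * h ^ θ * gridFloor h (T ω) ≤ L * K * h ^ θ * T ω := by
        gcongr; exact gridFloor_le hh _
    _ = _ := by ring

theorem lintegral_last_part_le (H : RandomTimeSetting P γ θ K L x X T g) {h : ℝ} (hh : 0 < h) :
    ∫⁻ ω, (∫⁻ s in Set.Ioc (gridFloor h (T ω)) (T ω), ‖g (X s.toNNReal ω)‖ₑ) ∂P ≤
      ∫⁻ ω, ENNReal.ofReal (h ^ θ * (|g x| * (1 + T ω) + L * K * T ω)) ∂P := by
  have hK := H.nonneg_moment
  have hL := H.nonneg_holder
  have hθ := H.pos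
  have hS : MeasurableSet {p : ℝ≥0 × ℝ | p.2 ∈ Set.Ioc (gridFloor h p.1) (p.1 : ℝ)} :=
    (measurableSet_lt ((measurable_gridFloor h).comp measurable_fst) measurable_snd).inter
      (measurableSet_le measurable_snd (by fun_prop))
  have hmain := H.lintegral_lintegral_mul_le
    (k := fun T s => (Set.Ioc (gridFloor h T) (T : ℝ)).indicator 1 s) (measurable_one.indicator hS)
  simp only [lintegral_indicator_one_mul measurableSet_Ioc] at hmain
  refine hmain.trans (lintegral_mono fun ω => ?_)
  calc ∫⁻ s in Set.Ioc (gridFloor h (T ω)) (T ω),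
          ENNReal.ofReal (|g x| + L * K * (s.toNNReal : ℝ) ^ θ)
      ≤ ∫⁻ _ in Set.Ioc (gridFloor h (T ω)) (T ω),
          ENNReal.ofReal (|g x| + L * K * (T ω : ℝ) ^ θ) := by
        refine setLIntegral_mono' measurableSet_Ioc fun s hs => ?_
        have : s.toNNReal ≤ T ω := Real.toNNReal_le_iff_le_coe.2 hs.2
        gcongr
    _ = ENNReal.ofReal ((|g x| + L * K * (T ω : ℝ) ^ θ) * (T ω - gridFloor h (T ω))) := by
        rw [setLIntegral_const, Real.volume_Ioc, ENNReal.ofReal_mul (by positivity)]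
    _ ≤ ENNReal.ofReal (h ^ θ * (|g x| * (1 + T ω) + L * K * T ω)) := by
        refine ENNReal.ofReal_le_ofReal ?_
        calc (|g x| + L * K * (T ω : ℝ) ^ θ) * (T ω - gridFloor h (T ω))
            ≤ (|g x| + L * K * (T ω : ℝ) ^ θ) * (h ^ θ * (T ω : ℝ) ^ (1 - θ)) := by
              gcongr; exact sub_gridFloor_le hh hθ.le H.lt_one.le _
          _ = h ^ θ * ((T ω : ℝ) ^ (1 - θ) * (|g x| + L * K * (T ω : ℝ) ^ θ)) := by ring
          _ ≤ _ := by
              gcongr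
              exact rpow_mul_add_le hθ.le H.lt_one (abs_nonneg _) (T ω).coe_nonneg

/-- The discretisation part and the last piece each contribute one `L K T`, hence the factor `2`;
the initial value `g x` enters only through the last piece. -/
theorem error_bound (H : RandomTimeSetting P γ θ K L x X T g) {h : ℝ} (hh : 0 < h) :
    Integrable (fun ω => (∫ s in (0 : ℝ)..(T ω : ℝ), g (X s.toNNReal ω)) -
        ∫ s in (0 : ℝ)..gridFloor h (T ω), g (X (gridPred h s) ω)) P ∧
      ∫ ω, |(∫ s in (0 : ℝ)..(T ω : ℝ), g (X s.toNNReal ω)) -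
        ∫ s in (0 : ℝ)..gridFloor h (T ω), g (X (gridPred h s) ω)| ∂P ≤
      (∫ ω, (|g x| * (1 + T ω) + 2 * (L * K * T ω)) ∂P) * h ^ θ := by
  have hK := H.nonneg_moment
  have hL := H.nonneg_holder
  set D : Ω → ℝ := fun ω => (∫ s in (0 : ℝ)..(T ω : ℝ), g (X s.toNNReal ω)) -
    ∫ s in (0 : ℝ)..gridFloor h (T ω), g (X (gridPred h s) ω)
  set B : Ω → ℝ := fun ω => |g x| * (1 + T ω) + 2 * (L * K * T ω) with hB
  have hB0 : ∀ ω, 0 ≤ B ω := fun ω => by positivity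
  have hTm : Measurable fun ω => (T ω : ℝ) := H.measurable_time.coe_nnreal_real
  have hTint : Integrable (fun ω => (T ω : ℝ)) P := by
    refine ⟨hTm.aestronglyMeasurable, ?_⟩
    simpa [HasFiniteIntegral] using lt_top_iff_ne_top.2 H.lintegral_time
  have hBint : Integrable B P :=
    (((integrable_const 1).add hTint).const_mul _).add ((hTint.const_mul _).const_mul _)
  have hDB : ∫⁻ ω, ‖D ω‖ₑ ∂P ≤ ENNReal.ofReal ((∫ ω, B ω ∂P) * h ^ θ) := by
    calc ∫⁻ ω, ‖D ω‖ₑ ∂P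
        ≤ ∫⁻ ω, ((∫⁻ s in Set.Ioc 0 (gridFloor h (T ω)),
            ‖g (X s.toNNReal ω) - g (X (gridPred h s) ω)‖ₑ) +
            ∫⁻ s in Set.Ioc (gridFloor h (T ω)) (T ω), ‖g (X s.toNNReal ω)‖ₑ) ∂P := by
          refine lintegral_mono_ae ?_
          filter_upwards [H.ae_intervalIntegrable] with ω hω
          exact enorm_integral_sub_le (gridFloor_nonneg hh _) (gridFloor_le hh _) (hω (T ω))
            (sum_eq_integral_gridPred g (fun s => X s ω) hh _).1
      _ ≤ (∫⁻ ω, ENNReal.ofReal (h ^ θ * (L * K * T ω)) ∂P) +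
            ∫⁻ ω, ENNReal.ofReal (h ^ θ * (|g x| * (1 + T ω) + L * K * T ω)) ∂P := by
          rw [lintegral_add_left' (H.aemeasurable_sub_part h)]
          exact add_le_add (H.lintegral_sub_part_le hh) (H.lintegral_last_part_le hh)
      _ = ∫⁻ ω, ENNReal.ofReal (B ω * h ^ θ) ∂P := by
          rw [← lintegral_add_left (by fun_prop)]
          congr 1
          funext ω
          rw [← ENNReal.ofReal_add (by positivity) (by positivity), hB]
          ring_nf
      _ = ENNReal.ofReal ((∫ ω, B ω ∂P) * h ^ θ) := by
          rw [← integral_mul_const, ofReal_integral_eq_lintegral_ofReal (hBint.mul_const _)]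
          exact Eventually.of_forall fun ω => mul_nonneg (hB0 ω) (by positivity)
  have hDint : Integrable D P :=
    ⟨H.aestronglyMeasurable_error hh, hDB.trans_lt ENNReal.ofReal_lt_top⟩
  refine ⟨hDint, ?_⟩
  have hnorm := ofReal_integral_norm_eq_lintegral_enorm hDint
  rw [← hnorm] at hDB
  exact (ENNReal.ofReal_le_ofReal_iff
    (mul_nonneg (integral_nonneg hB0) (by positivity))).1 hDB

end RandomTimeSetting

/-! ### Application to the stable process and the passage time -/

theorem proposition3p3 {Ω : Type*} [MeasurableSpace Ω] (P : Measure Ω) [IsProbabilityMeasure P]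
    {d : ℕ} (α β γ L a t : ℝ) (hα : 0 < α) (hα1 : α < 1) (hβ : 0 < β) (hβ2 : β ≤ 2)
    (hγ : 0 < γ) (hγβ : γ < β / 2) (hat : a < t)
    (x : EuclideanSpace ℝ (Fin d))
    (X : ℝ≥0 → Ω → EuclideanSpace ℝ (Fin d)) (hX : IsIsotropicStableProcess β x X P)
    (τ : ℝ≥0 → Ω → ℝ) (hτ : IsStableSubordinator α τ P)
    (hXτ : IndepFun (fun ω s => X s ω) (fun ω s => τ s ω) P)
    (φ g : EuclideanSpace ℝ (Fin d) → ℝ) (hφ : Measurable φ)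
    (hg : ∀ y z, |g y - g z| ≤ L * gammaNorm γ (y - z)) :
    ∃ M : ℝ, ∀ h : ℝ, 0 < h →
      Integrable (fun ω => exactFunctional φ g X (passageTime τ a t) ω
          - riemannFunctional φ g X (passageTime τ a t) h ω) P ∧
        ∫ ω, |exactFunctional φ g X (passageTime τ a t) ω
          - riemannFunctional φ g X (passageTime τ a t) h ω| ∂P ≤ M * h ^ (γ / β) := by
  obtain ⟨K, hK, hmoment⟩ := hX.exists_lintegral_gammaNorm_le hβ hγ hγβ
  set T : Ω → ℝ≥0 := fun ω => (ratPassageTime a t fun s => τ s ω).toNNReal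
  have hpath : Measurable fun ω s => τ s ω := measurable_pi_lambda _ hτ.levy.measurable
  -- `L` carries no sign assumption, so it is replaced by `|L|`.
  have hg' : ∀ y z, |g y - g z| ≤ |L| * gammaNorm γ (y - z) := fun y z =>
    (hg y z).trans (mul_le_mul_of_nonneg_right (le_abs_self L) (gammaNorm_nonneg γ _))
  have hTmeas : Measurable fun f : ℝ≥0 → ℝ => (ratPassageTime a t f).toNNReal :=
    (measurable_ratPassageTime a t).ennreal_toNNReal
  have H : RandomTimeSetting P γ (γ / β) K |L| x X T g :=
    { levy := hX.levy
      start := hX.start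
      moment := hmoment
      measurable_time := hTmeas.comp hpath
      indep := hXτ.symm.comp hTmeas measurable_id
      lintegral_time := ((lintegral_mono fun ω => ENNReal.coe_toNNReal_le_self).trans_lt
        (hτ.lintegral_ratPassageTime_lt_top hat)).ne
      continuous := continuous_of_abs_sub_le_gammaNorm hγ hg
      holder := hg'
      pos := by positivity
      lt_one := by rw [div_lt_one hβ]; linarith
      nonneg_moment := hK
      nonneg_holder := abs_nonneg L }
  refine ⟨∫ ω, (|g x| * (1 + T ω) + 2 * (|L| * K * T ω)) ∂P, fun h hh => ?_⟩
  have heq : (fun ω => exactFunctional φ g X (passageTime τ a t) ω -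
      riemannFunctional φ g X (passageTime τ a t) h ω) =ᵐ[P]
      fun ω => (∫ s in (0 : ℝ)..(T ω : ℝ), g (X s.toNNReal ω)) -
        ∫ s in (0 : ℝ)..gridFloor h (T ω), g (X (gridPred h s) ω) := by
    -- Monotone paths allow `T` to replace the passage time; the common term in `φ` then cancels.
    filter_upwards [hτ.mono] with ω hω
    rw [exactFunctional, riemannFunctional, passageTime_eq_toNNReal_ratPassageTime hω,
      add_sub_add_left_eq_sub, (sum_eq_integral_gridPred g (fun s => X s ω) hh _).2]
    rfl
  obtain ⟨h1, h2⟩ := H.error_bound hh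
  refine ⟨h1.congr heq.symm, le_of_eq_of_le (integral_congr_ae ?_) h2⟩
  filter_upwards [heq] with ω hω
  rw [hω]
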